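/- All spaces are Hausdorff. An arc is a space homeomorphic to $[0,1]$, a simple closed curve is a space homeomorphic to the unit circle, and a tree is a connected space that is the union of finitely many arcs and contains no simple closed curve. For a space $Y$, a subset $S \subseteq Y$ is called a nontrivial convergent sequence in $Y$ if $S$ is countably infinite and there is a point $x \in S$ such that $S \setminus U$ is finite for every open set $U \subseteq Y$ with $x \in U$. Let $\mathcal{S}_c(Y)$ be the set of all nontrivial convergent sequences in $Y$ (each of which is a nonempty compact subset of $Y$), endowed with the Vietoris topology, which has as a base the sets $$\Big\{ S \in \mathcal{S}_c(Y) : S \subseteq \bigcup \mathcal{U} \text{ and } S \cap U \neq \emptyset \text{ for all } U \in \mathcal{U} \Big\},$$ where $\mathcal{U}$ ranges over the finite families of open subsets of $Y$. **Theorem.** Let $X$ be a tree and let $Y$ be a connected subset of $X$ with more than one point, with the subspace topology. Then $\mathcal{S}_c(Y)$ is contractible: there are $P \in \mathcal{S}_c(Y)$ and a continuous map $h : \mathcal{S}_c(Y) \times [0,1] \to \mathcal{S}_c(Y)$ with $h(S,0) = S$ and $h(S,1) = P$ for all $S \in \mathcal{S}_c(Y)$. -/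

import Mathlib

open TopologicalSpace

/-- An arc in `X`: a subspace homeomorphic to `[0, 1]`. -/
def IsTopArc {X : Type*} [TopologicalSpace X] (A : Set X) : Prop :=
  Nonempty (A ≃ₜ unitInterval)

/-- A simple closed curve in `X`: a subspace homeomorphic to the unit circle. -/
def IsTopSimpleClosedCurve {X : Type*} [TopologicalSpace X] (C : Set X) : Prop :=
  Nonempty (C ≃ₜ Circle)

/-- A tree: a connected Hausdorff space which is the union of finitely many arcs and contains
no simple closed curve. -/
structure IsTopTree (X : Type*) [TopologicalSpace X] : Prop where
  t2 : T2Space X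
  connected : ConnectedSpace X
  finite_union_arcs : ∃ 𝒜 : Set (Set X), 𝒜.Finite ∧ (∀ A ∈ 𝒜, IsTopArc A) ∧ ⋃₀ 𝒜 = Set.univ
  no_simple_closed_curve : ∀ C : Set X, ¬ IsTopSimpleClosedCurve C

/-- A nontrivial convergent sequence in `X`, as a subset: a countably infinite set `S` with a
point `x ∈ S` such that every open neighbourhood of `x` contains all but finitely many points
of `S`. -/
def IsNontrivialConvergentSeq {X : Type*} [TopologicalSpace X] (S : Set X) : Prop :=
  S.Countable ∧ S.Infinite ∧ ∃ x ∈ S, ∀ U : Set X, IsOpen U → x ∈ U → (S \ U).Finite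

/-- The hyperspace `S_c(X)` of all nontrivial convergent sequences in a Hausdorff space `X`, a
subspace of the space of nonempty compact subsets of `X`, which carries the Vietoris topology
(in a Hausdorff space compact subsets are automatically closed). -/
abbrev ConvergentSeqHyperspace (X : Type*) [TopologicalSpace X] : Type _ :=
  {S : NonemptyCompacts X // IsNontrivialConvergentSeq (S : Set X)}

/-! A continuous map with finite fibers sends nontrivial convergent sequences to nontrivial
convergent sequences, so a homotopy all of whose stages have finite fibers induces a homotopy of
hyperspaces (`ConvergentSeqHyperspace.homotopic_map`). The finiteness is the whole difficulty:
contracting or retracting the underlying space may make a sequence finite.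

For a nondegenerate interval, the sequence is shrunk to a point while a fixed model sequence grows
out of that point, so infinitude is never lost
(`Set.OrdConnected.contractibleSpace_convergentSeqHyperspace`).

A tree arises from a point by attaching arcs at one endpoint (`IsTopTree.isArcBuilt_univ`), and the
proof is by induction on this construction. If a connected `Y` lies neither in the old part `T` nor
in the last arc, the last arc is not collapsed but folded onto an arc of `Y ∩ T` issuing from the
attaching point. The fold has finite fibers at all times, so the hyperspace of `Y` is dominated by
that of `Y ∩ T` (`IsArcAttached.contractibleSpace_of_inter`). -/

open Set Filter Topology unitInterval

/-! ### Functoriality of the hyperspace under maps with finite fibers. -/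

section Hyperspace

variable {Y Z : Type*} [TopologicalSpace Y] [TopologicalSpace Z]

theorem IsNontrivialConvergentSeq.image {S : Set Y} (hS : IsNontrivialConvergentSeq S)
    {f : Y → Z} (hf : Continuous f) (hinf : (f '' S).Infinite) :
    IsNontrivialConvergentSeq (f '' S) := by
  obtain ⟨hc, -, x, hx, h⟩ := hS
  refine ⟨hc.image f, hinf, f x, mem_image_of_mem f hx, fun U hU hxU => ?_⟩
  refine ((h (f ⁻¹' U) (hU.preimage hf) hxU).image f).subset ?_
  rintro _ ⟨⟨y, hy, rfl⟩, hyU⟩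
  exact ⟨y, ⟨hy, hyU⟩, rfl⟩

theorem IsNontrivialConvergentSeq.union_finite {S F : Set Y} (hS : IsNontrivialConvergentSeq S)
    (hF : F.Finite) : IsNontrivialConvergentSeq (S ∪ F) := by
  obtain ⟨hc, hi, x, hx, h⟩ := hS
  refine ⟨hc.union hF.countable, hi.mono subset_union_left, x, Or.inl hx, fun U hU hxU => ?_⟩
  rw [union_sdiff_distrib]
  exact (h U hU hxU).union (hF.subset sdiff_subset)

theorem Set.Infinite.image_of_finite_fibers {Y Z : Type*} {S : Set Y} (hS : S.Infinite) {f : Y → Z}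
    (hf : ∀ z, (f ⁻¹' {z}).Finite) : (f '' S).Infinite := fun h =>
  hS ((Finite.preimage' h fun z _ => hf z).subset (subset_preimage_image f S))

theorem IsNontrivialConvergentSeq.map {S : NonemptyCompacts Y}
    (hS : IsNontrivialConvergentSeq (S : Set Y)) {f : Y → Z} (hf : Continuous f)
    (hfin : ∀ z, (f ⁻¹' {z}).Finite) :
    IsNontrivialConvergentSeq (S.map f hf : Set Z) :=
  hS.image hf (hS.2.1.image_of_finite_fibers hfin)

/-- The map of hyperspaces of convergent sequences induced by a continuous map with finite
fibers. -/
def ConvergentSeqHyperspace.map (f : C(Y, Z)) (hf : ∀ z, (f ⁻¹' {z}).Finite) :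
    C(ConvergentSeqHyperspace Y, ConvergentSeqHyperspace Z) where
  toFun S := ⟨S.1.map f f.continuous, S.2.map f.continuous hf⟩
  continuous_toFun :=
    (f.continuous.nonemptyCompacts_map.comp continuous_subtype_val).subtype_mk _

theorem ConvergentSeqHyperspace.homotopic_map {f g : C(Y, Z)} (H : f.Homotopy g)
    (hH : ∀ t z, ((fun y => H (t, y)) ⁻¹' {z}).Finite)
    (hf : ∀ z, (f ⁻¹' {z}).Finite) (hg : ∀ z, (g ⁻¹' {z}).Finite) :
    (ConvergentSeqHyperspace.map f hf).Homotopic (ConvergentSeqHyperspace.map g hg) := by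
  have hcont : ∀ t, Continuous fun y => H (t, y) := fun t => by fun_prop
  refine ⟨⟨⟨fun p => ⟨p.2.1.map (fun y => H (p.1, y)) (hcont p.1),
    p.2.2.map (hcont p.1) (hH p.1)⟩, ?_⟩, fun S => ?_, fun S => ?_⟩⟩
  · refine Continuous.subtype_mk ?_ _
    exact Continuous.nonemptyCompacts_map'
      (f := fun p : I × ConvergentSeqHyperspace Y => p.2.1)
      (g := fun p y => H (p.1, y)) (by fun_prop) (by unfold Function.uncurry; fun_prop)
  · apply Subtype.ext; apply NonemptyCompacts.ext
    simp [ConvergentSeqHyperspace.map]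
  · apply Subtype.ext; apply NonemptyCompacts.ext
    simp [ConvergentSeqHyperspace.map]

/-- Contractibility of the hyperspace passes to a space that is homotopy dominated through maps
with finite fibers. -/
theorem ConvergentSeqHyperspace.contractibleSpace_of_dominated
    [ContractibleSpace (ConvergentSeqHyperspace Z)] (r : C(Y, Z)) (i : C(Z, Y))
    (hi : ∀ y, (i ⁻¹' {y}).Finite) (H : (ContinuousMap.id Y).Homotopy (i.comp r))
    (hH : ∀ t z, ((fun y => H (t, y)) ⁻¹' {z}).Finite) :
    ContractibleSpace (ConvergentSeqHyperspace Y) := by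
  have hir : ∀ y, (i.comp r ⁻¹' {y}).Finite := fun y => by
    simpa [Function.comp_def] using hH 1 y
  have hid : ∀ y, (ContinuousMap.id Y ⁻¹' {y}).Finite := fun y => by simp
  have hr : ∀ z, (r ⁻¹' {z}).Finite := fun z => (hir (i z)).subset fun y hy => by
    simp only [mem_preimage, mem_singleton_iff, ContinuousMap.comp_apply] at hy ⊢
    rw [hy]
  rw [contractible_iff_id_nullhomotopic]
  have h1 := ConvergentSeqHyperspace.homotopic_map H hH hid hir
  have h2 : ConvergentSeqHyperspace.map (ContinuousMap.id Y) hid = ContinuousMap.id _ := by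
    ext1 S
    apply Subtype.ext; apply NonemptyCompacts.ext
    simp [ConvergentSeqHyperspace.map]
  have h3 : ConvergentSeqHyperspace.map (i.comp r) hir =
      (ConvergentSeqHyperspace.map i hi).comp (ConvergentSeqHyperspace.map r hr) := by
    ext1 S
    apply Subtype.ext; apply NonemptyCompacts.ext
    simp [ConvergentSeqHyperspace.map, image_image]
  -- `i ∘ r` factors through a contractible hyperspace, hence induces a nullhomotopic map, and it is
  -- homotopic to the identity.
  have h4 := ((id_nullhomotopic (ConvergentSeqHyperspace Z)).comp_right
    (ConvergentSeqHyperspace.map i hi)).comp_left (ConvergentSeqHyperspace.map r hr)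
  rw [ContinuousMap.comp_id] at h4
  rw [h2, h3] at h1
  obtain ⟨P, hP⟩ := h4
  exact ⟨P, h1.trans hP⟩

theorem Homeomorph.contractibleSpace_convergentSeqHyperspace (e : Y ≃ₜ Z)
    [ContractibleSpace (ConvergentSeqHyperspace Z)] :
    ContractibleSpace (ConvergentSeqHyperspace Y) := by
  have h : (e.symm : C(Z, Y)).comp (e : C(Y, Z)) = ContinuousMap.id Y := by ext; simp
  refine ConvergentSeqHyperspace.contractibleSpace_of_dominated (e : C(Y, Z)) (e.symm : C(Z, Y))
    (fun y => (finite_singleton y).preimage e.symm.injective.injOn)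
    ((ContinuousMap.Homotopy.refl _).cast rfl h.symm) fun t z => ?_
  exact finite_singleton z

end Hyperspace

/-- The least element of a nonempty compact set depends continuously on the set. -/
theorem TopologicalSpace.NonemptyCompacts.exists_continuous_selection (α : Type*) [LinearOrder α]
    [TopologicalSpace α] [OrderTopology α] :
    ∃ m : NonemptyCompacts α → α, Continuous m ∧ ∀ K, m K ∈ K := by
  choose m hm using fun K : NonemptyCompacts α => K.isCompact.exists_isLeast K.nonempty
  -- Only open rays need checking: `m K > a` says that `K` lies in a ray, `m K < a` that `K` meets
  -- one; both are Vietoris open.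
  refine ⟨m, OrderTopology.continuous_iff.2 fun a => ⟨?_, ?_⟩, fun K => (hm K).1⟩
  · convert! NonemptyCompacts.isOpen_subsets_of_isOpen (isOpen_Ioi (a := a)) using 1
    ext K
    exact ⟨fun h x hx => lt_of_lt_of_le h ((hm K).2 hx), fun h => h (hm K).1⟩
  · convert! NonemptyCompacts.isOpen_inter_nonempty_of_isOpen (isOpen_Iio (a := a)) using 1
    ext K
    exact ⟨fun h => ⟨m K, (hm K).1, h⟩, fun ⟨x, hx, hxa⟩ => lt_of_le_of_lt ((hm K).2 hx) hxa⟩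

/-! ### Intervals of the real line. -/

section Interval

theorem isNontrivialConvergentSeq_insert_range {Y : Type*} [TopologicalSpace Y] {u : ℕ → Y} {a : Y}
    (hu : Tendsto u atTop (𝓝 a)) (hinj : Function.Injective u) :
    IsNontrivialConvergentSeq (insert a (range u)) := by
  refine ⟨(countable_range u).insert a,
    (infinite_range_of_injective hinj).mono (subset_insert _ _), a, mem_insert _ _,
    fun U hU haU => ?_⟩
  have h := hu.eventually (hU.mem_nhds haU)
  rw [← Nat.cofinite_eq_atTop] at h
  refine (Set.Finite.image u h).subset ?_
  rintro _ ⟨rfl | ⟨n, rfl⟩, hn⟩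
  · exact (hn haU).elim
  · exact ⟨n, hn, rfl⟩

/-- The point `1 / (n + 1)` of the unit interval. -/
noncomputable def unitInterval.oneDivSucc (n : ℕ) : I :=
  ⟨1 / ((n : ℝ) + 1), unitInterval.div_mem zero_le_one (by positivity)
    (by linarith [n.cast_nonneg (α := ℝ)])⟩

theorem unitInterval.oneDivSucc_injective : Function.Injective oneDivSucc := fun m n h => by
  have h' : 1 / ((m : ℝ) + 1) = 1 / ((n : ℝ) + 1) := congrArg Subtype.val h
  have hm : (m : ℝ) + 1 ≠ 0 := by positivity
  have hn : (n : ℝ) + 1 ≠ 0 := by positivity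
  field_simp at h'
  exact_mod_cast (add_right_cancel h').symm

theorem unitInterval.tendsto_oneDivSucc : Tendsto oneDivSucc atTop (𝓝 0) :=
  tendsto_subtype_rng.2 tendsto_one_div_add_atTop_nhds_zero_nat

/-- The model convergent sequence `{0} ∪ {1 / (n + 1)}` in the unit interval. -/
noncomputable def unitInterval.modelSeq : ConvergentSeqHyperspace I :=
  ⟨⟨⟨insert 0 (range oneDivSucc), tendsto_oneDivSucc.isCompact_insert_range⟩,
    insert_nonempty _ _⟩,
    isNontrivialConvergentSeq_insert_range tendsto_oneDivSucc oneDivSucc_injective⟩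

/-- The segment map of a real interval. -/
def Set.OrdConnected.segmentMap {J : Set ℝ} (hJ : J.OrdConnected) (t : I) (x y : J) : J :=
  ⟨(1 - t) * x + t * y, hJ.convex x.2 y.2 (sub_nonneg.2 t.2.2) t.2.1 (by ring)⟩

theorem Set.OrdConnected.continuous_segmentMap {J : Set ℝ} (hJ : J.OrdConnected) :
    Continuous fun p : I × J × J => hJ.segmentMap p.1 p.2.1 p.2.2 := by
  unfold Set.OrdConnected.segmentMap
  fun_prop

theorem Set.OrdConnected.contractibleSpace_convergentSeqHyperspace {J : Set ℝ}
    (hJ : J.OrdConnected) (hJn : J.Nontrivial) :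
    ContractibleSpace (ConvergentSeqHyperspace J) := by
  obtain ⟨p, hp, q, hq, hpq⟩ := hJn
  have := hJ
  set p' : J := ⟨p, hp⟩ with hp'
  set q' : J := ⟨q, hq⟩ with hq'
  have hcs := hJ.continuous_segmentMap
  obtain ⟨m, hmc, hm⟩ := NonemptyCompacts.exists_continuous_selection J
  have e0 : ∀ x y : J, hJ.segmentMap 0 x y = x := fun x y => Subtype.ext (by
    simp [Set.OrdConnected.segmentMap])
  have e1 : ∀ x y : J, hJ.segmentMap 1 x y = y := fun x y => Subtype.ext (by
    simp [Set.OrdConnected.segmentMap])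
  -- adjoining the base point
  let f1 : C(ConvergentSeqHyperspace J, ConvergentSeqHyperspace J) :=
    ⟨fun S => ⟨S.1 ⊔ {p'}, S.2.union_finite (finite_singleton p')⟩, by fun_prop⟩
  have hom1 : (ContinuousMap.id _).Homotopic f1 := by
    -- The extra point starts at the minimum, which already belongs to the set, and travels to `p'`.
    refine ⟨⟨⟨fun a => ⟨a.2.1 ⊔ {hJ.segmentMap a.1 (m a.2.1) p'},
      a.2.2.union_finite (finite_singleton _)⟩, ?_⟩, fun S => ?_, fun S => ?_⟩⟩
    · refine Continuous.subtype_mk ?_ _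
      have : Continuous fun a : I × ConvergentSeqHyperspace J =>
          hJ.segmentMap a.1 (m a.2.1) p' :=
        hcs.comp (by fun_prop : Continuous fun a : I × ConvergentSeqHyperspace J =>
          (a.1, m a.2.1, p'))
      exact (by fun_prop : Continuous fun a : I × ConvergentSeqHyperspace J => a.2.1).sup
        (NonemptyCompacts.continuous_singleton.comp this)
    · apply Subtype.ext; apply NonemptyCompacts.ext
      have : m S.1 ∈ (S.1 : Set J) := hm S.1
      simp [e0, this]
    · apply Subtype.ext; apply NonemptyCompacts.ext
      simp [e1, f1]
  -- shrinking to the base point while growing the model sequence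
  let g : I → I → J := fun t u => hJ.segmentMap ⟨max 0 ((u : ℝ) - σ t), le_max_left _ _,
    max_le zero_le_one (by linarith [u.2.2, (σ t).2.1])⟩ p' q'
  have hg : Continuous (Function.uncurry g) :=
    hcs.comp (by fun_prop : Continuous fun a : I × I =>
      ((⟨max 0 ((a.2 : ℝ) - σ a.1), _⟩ : I), p', q'))
  have hgt : ∀ t, Continuous (g t) := fun t =>
    hg.comp (by fun_prop : Continuous fun u : I => (t, u))
  have hst : ∀ t, Continuous fun x => hJ.segmentMap t x p' := fun t =>
    hcs.comp (by fun_prop : Continuous fun x : J => (t, x, p'))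
  have g_low : ∀ t u : I, (u : ℝ) ≤ σ t → g t u = p' := fun t u h => by
    have : max 0 ((u : ℝ) - σ t) = 0 := max_eq_left (by linarith)
    apply Subtype.ext
    simp only [g, Set.OrdConnected.segmentMap, this]
    simp
  have g1 : Function.Injective (g 1) := fun u v h => by
    have h' := congrArg Subtype.val h
    simp only [g, Set.OrdConnected.segmentMap, symm_one, Icc.coe_zero, sub_zero,
      max_eq_right u.2.1, max_eq_right v.2.1, hp', hq'] at h'
    have : ((u : ℝ) - v) * (q - p) = 0 := by linarith
    rcases mul_eq_zero.1 this with h | h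
    · exact Subtype.ext (sub_eq_zero.1 h)
    · exact (hpq (sub_eq_zero.1 h).symm).elim
  have gfin : ∀ t : I, t ≠ 1 → (g t '' (modelSeq.1 : Set I)).Finite := fun t ht => by
    have hpos : (0 : ℝ) < σ t := by
      have : (t : ℝ) < 1 := lt_of_le_of_ne t.2.2 (fun h => ht (Subtype.ext h))
      simpa using this
    have hfin : ((modelSeq.1 : Set I) \ {u : I | (u : ℝ) < σ t}).Finite := by
      have h : ∀ᶠ n in cofinite, ((oneDivSucc n : I) : ℝ) < σ t := by
        rw [Nat.cofinite_eq_atTop]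
        exact tendsto_one_div_add_atTop_nhds_zero_nat.eventually (gt_mem_nhds hpos)
      refine (Set.Finite.image oneDivSucc h).subset ?_
      rintro _ ⟨rfl | ⟨n, rfl⟩, hn⟩
      · exact (hn hpos).elim
      · exact ⟨n, hn, rfl⟩
    refine ((hfin.image (g t)).insert p').subset ?_
    rintro _ ⟨u, hu, rfl⟩
    by_cases hut : (u : ℝ) < σ t
    · exact Or.inl (g_low t u hut.le)
    · exact Or.inr ⟨u, ⟨hu, hut⟩, rfl⟩
  have hP : IsNontrivialConvergentSeq (modelSeq.1.map (g 1) (hgt 1) : Set J) :=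
    modelSeq.2.map (hgt 1) fun z => (finite_singleton z).preimage g1.injOn
  rw [contractible_iff_id_nullhomotopic]
  refine ⟨⟨modelSeq.1.map (g 1) (hgt 1), hP⟩, hom1.trans ?_⟩
  have hseq : ∀ a : I × ConvergentSeqHyperspace J, IsNontrivialConvergentSeq
      ((a.2.1.map (fun x => hJ.segmentMap a.1 x p') (hst a.1) ⊔
        modelSeq.1.map (g a.1) (hgt a.1) : NonemptyCompacts J) : Set J) := by
    rintro ⟨t, S⟩
    rw [NonemptyCompacts.coe_sup]
    -- At `t = 1` the model part is infinite and the shrunken set is a point; for `t < 1` the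
    -- shrinking is injective and the model part is finite.
    by_cases ht : t = 1
    · subst ht
      rw [union_comm]
      refine hP.union_finite ((finite_singleton p').subset ?_)
      rintro _ ⟨x, -, rfl⟩
      exact e1 x p'
    · refine (S.2.map (hst t) fun z => ?_).union_finite (gfin t ht)
      refine (finite_singleton z).preimage fun x _ y _ hxy => ?_
      have h' := congrArg Subtype.val hxy
      simp only [Set.OrdConnected.segmentMap] at h'
      have ht' : (1 - t : ℝ) ≠ 0 := fun h => ht (Subtype.ext (sub_eq_zero.1 h).symm)
      exact Subtype.ext (mul_left_cancel₀ ht' (add_right_cancel h'))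
  refine ⟨⟨⟨fun a => ⟨_, hseq a⟩, ?_⟩, fun S => ?_, fun S => ?_⟩⟩
  · refine Continuous.subtype_mk (Continuous.sup ?_ ?_) _
    · exact Continuous.nonemptyCompacts_map'
        (f := fun a : I × ConvergentSeqHyperspace J => a.2.1)
        (g := fun a x => hJ.segmentMap a.1 x p') (by fun_prop)
        (hcs.comp (by fun_prop : Continuous fun b : (I × ConvergentSeqHyperspace J) × J =>
          (b.1.1, b.2, p')))
    · exact Continuous.nonemptyCompacts_map'
        (f := fun a : I × ConvergentSeqHyperspace J => modelSeq.1)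
        (g := fun a x => g a.1 x) (by fun_prop)
        (hg.comp (by fun_prop : Continuous fun b : (I × ConvergentSeqHyperspace J) × I =>
          (b.1.1, b.2)))
  · apply Subtype.ext; apply NonemptyCompacts.ext
    -- This is why `p'` was adjoined beforehand: the second homotopy starts at `S ∪ {p'}`.
    have : g 0 '' (modelSeq.1 : Set I) = {p'} := by
      refine (modelSeq.1.nonempty.image _).subset_singleton_iff.1 ?_
      rintro _ ⟨u, -, rfl⟩
      exact g_low 0 u (by simpa using u.2.2)
    simp only [NonemptyCompacts.coe_sup, NonemptyCompacts.coe_map, this, f1, e0, image_id',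
      ContinuousMap.coe_mk, NonemptyCompacts.coe_singleton]
  · apply Subtype.ext; apply NonemptyCompacts.ext
    have h0 : p' ∈ g 1 '' (modelSeq.1 : Set I) :=
      ⟨0, Or.inl rfl, g_low 1 0 (by simp)⟩
    have : (fun _ : J => p') '' (S.1 : Set J) = {p'} := S.1.nonempty.image_const p'
    simp only [NonemptyCompacts.coe_sup, NonemptyCompacts.coe_map, e1, this,
      ContinuousMap.const_apply]
    exact union_eq_self_of_subset_left (singleton_subset_iff.2 h0)

end Interval

/-! ### Trees are built by attaching arcs. -/

section Arcs

variable {X : Type*} [TopologicalSpace X]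

/-- `C` is an arc with endpoints `x` and `y`. -/
def IsArcBetween (C : Set X) (x y : X) : Prop :=
  ∃ φ : ℝ → X, ContinuousOn φ (Icc 0 1) ∧ InjOn φ (Icc 0 1) ∧ φ 0 = x ∧ φ 1 = y ∧
    φ '' Icc 0 1 = C

theorem image_lineMap_Icc (u v : ℝ) : AffineMap.lineMap u v '' Icc (0 : ℝ) 1 = uIcc u v := by
  rw [← segment_eq_image_lineMap, segment_eq_uIcc]

theorem isArcBetween_image_uIcc {φ : ℝ → X} {u v : ℝ} (huv : u ≠ v)
    (hc : ContinuousOn φ (uIcc u v)) (hi : InjOn φ (uIcc u v)) :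
    IsArcBetween (φ '' uIcc u v) (φ u) (φ v) := by
  have hm : MapsTo (AffineMap.lineMap u v) (Icc (0 : ℝ) 1) (uIcc u v) :=
    mapsTo_iff_image_subset.2 (image_lineMap_Icc u v).le
  refine ⟨φ ∘ AffineMap.lineMap u v, hc.comp (by fun_prop) hm,
    hi.comp (AffineMap.lineMap_injective ℝ huv).injOn hm, by simp, by simp, ?_⟩
  rw [image_comp, image_lineMap_Icc]

theorem IsArcBetween.symm {C : Set X} {x y : X} (h : IsArcBetween C x y) :
    IsArcBetween C y x := by
  obtain ⟨φ, hc, hi, rfl, rfl, rfl⟩ := h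
  have e : uIcc (1 : ℝ) 0 = Icc 0 1 := uIcc_of_ge zero_le_one
  rw [← e] at hc hi ⊢
  exact isArcBetween_image_uIcc one_ne_zero hc hi

/-- Run through `φ` on `[0, 1]` and then through `ψ` on `[0, 1]`. -/
noncomputable def concatParam {X : Type*} (φ ψ : ℝ → X) (s : ℝ) : X :=
  if s ≤ 1 / 2 then φ (2 * s) else ψ (2 * s - 1)

theorem continuousOn_concatParam {φ ψ : ℝ → X} (hφ : ContinuousOn φ (Icc 0 1))
    (hψ : ContinuousOn ψ (Icc 0 1)) (h : φ 1 = ψ 0) :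
    ContinuousOn (concatParam φ ψ) (Icc 0 1) := by
  have e : Icc (0 : ℝ) 1 = Icc 0 (1 / 2) ∪ Icc (1 / 2) 1 :=
    (Icc_union_Icc_eq_Icc (by norm_num) (by norm_num)).symm
  rw [e]
  refine ContinuousOn.union_of_isClosed ?_ ?_ isClosed_Icc isClosed_Icc
  · refine (hφ.comp (f := fun s : ℝ => 2 * s) (by fun_prop) fun s hs => ?_).congr fun s hs => ?_
    · constructor <;> linarith [hs.1, hs.2]
    · simp only [concatParam, if_pos hs.2, Function.comp]
  · refine (hψ.comp (f := fun s : ℝ => 2 * s - 1) (by fun_prop) fun s hs => ?_).congr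
      fun s hs => ?_
    · constructor <;> linarith [hs.1, hs.2]
    · rcases hs.1.eq_or_lt with rfl | hlt
      · simp [concatParam, h]
      · simp only [concatParam, if_neg (not_le.2 hlt), Function.comp]

theorem image_concatParam {X : Type*} {φ ψ : ℝ → X} (h : φ 1 = ψ 0) :
    concatParam φ ψ '' Icc 0 1 = φ '' Icc 0 1 ∪ ψ '' Icc 0 1 := by
  apply Subset.antisymm
  · rintro _ ⟨s, hs, rfl⟩
    unfold concatParam
    split_ifs with hs'
    · exact Or.inl ⟨_, ⟨by linarith [hs.1], by linarith⟩, rfl⟩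
    · push Not at hs'
      exact Or.inr ⟨_, ⟨by linarith, by linarith [hs.2]⟩, rfl⟩
  · rintro _ (⟨s, hs, rfl⟩ | ⟨s, hs, rfl⟩)
    · refine ⟨s / 2, ⟨by linarith [hs.1], by linarith [hs.2]⟩, ?_⟩
      rw [concatParam, if_pos (by linarith [hs.2])]
      congr 1
      ring
    · rcases hs.1.eq_or_lt with rfl | hlt
      · exact ⟨1 / 2, by norm_num, by simp [concatParam, h]⟩
      · refine ⟨(s + 1) / 2, ⟨by linarith [hs.1], by linarith [hs.2]⟩, ?_⟩
        rw [concatParam, if_neg (by linarith)]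
        congr 1
        ring

/-- A concatenation of injective paths is injective on `D` as soon as the second path avoids the
first one at the parameters occurring in `D`. -/
theorem injOn_concatParam {X : Type*} {φ ψ : ℝ → X} {D : Set ℝ} (hD : D ⊆ Icc 0 1)
    (hφ : InjOn φ (Icc 0 1)) (hψ : InjOn ψ (Icc 0 1))
    (h : ∀ s ∈ D, 1 / 2 < s → ∀ r ∈ Icc (0 : ℝ) 1, φ r ≠ ψ (2 * s - 1)) :
    InjOn (concatParam φ ψ) D := by
  intro s hs t ht hst
  have hs' := hD hs
  have ht' := hD ht
  unfold concatParam at hst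
  split_ifs at hst with h1 h2 h2
  · linarith [hφ ⟨by linarith [hs'.1], by linarith⟩ ⟨by linarith [ht'.1], by linarith⟩ hst]
  · exact (h t ht (not_le.1 h2) _ ⟨by linarith [hs'.1], by linarith⟩ hst).elim
  · exact (h s hs (not_le.1 h1) _ ⟨by linarith [ht'.1], by linarith⟩ hst.symm).elim
  · push Not at h1 h2
    linarith [hψ ⟨by linarith, by linarith [hs'.2]⟩ ⟨by linarith, by linarith [ht'.2]⟩ hst]

theorem IsArcBetween.trans {C D : Set X} {x y z : X} (hC : IsArcBetween C x y)
    (hD : IsArcBetween D y z) (hCD : C ∩ D ⊆ {y}) : IsArcBetween (C ∪ D) x z := by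
  obtain ⟨φ, hφc, hφi, rfl, rfl, rfl⟩ := hC
  obtain ⟨ψ, hψc, hψi, h01, rfl, rfl⟩ := hD
  refine ⟨concatParam φ ψ, continuousOn_concatParam hφc hψc h01.symm,
    injOn_concatParam subset_rfl hφi hψi fun s hs hs' r hr hrs => ?_, by simp [concatParam],
    by norm_num [concatParam], image_concatParam h01.symm⟩
  have hmem : 2 * s - 1 ∈ Icc (0 : ℝ) 1 := ⟨by linarith, by linarith [hs.2]⟩
  have h1 : ψ (2 * s - 1) = ψ 0 := by
    rw [h01]
    exact hCD ⟨⟨r, hr, hrs⟩, ⟨_, hmem, rfl⟩⟩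
  linarith [hψi hmem (left_mem_Icc.2 zero_le_one) h1]

/-- Going along `C` and back along `D` is a loop, injective on `[0, 1)`; it descends to an injective
continuous map from the circle, which is an embedding by compactness. -/
theorem IsArcBetween.isTopSimpleClosedCurve [T2Space X] {C D : Set X} {x y : X}
    (hC : IsArcBetween C x y) (hD : IsArcBetween D x y) (hCD : C ∩ D ⊆ {x, y}) :
    IsTopSimpleClosedCurve (C ∪ D) := by
  obtain ⟨φ, hφc, hφi, rfl, rfl, rfl⟩ := hC
  obtain ⟨ψ, hψc, hψi, h0, h1, rfl⟩ := hD.symm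
  set χ := concatParam φ ψ with hχ
  have hχc : ContinuousOn χ (Icc 0 1) := continuousOn_concatParam hφc hψc h0.symm
  have hχi : InjOn χ (Ico 0 1) := by
    refine injOn_concatParam Ico_subset_Icc_self hφi hψi fun s hs hs' r hr hrs => ?_
    have hmem : 2 * s - 1 ∈ Icc (0 : ℝ) 1 := ⟨by linarith, by linarith [hs.2]⟩
    rcases hCD ⟨⟨r, hr, hrs⟩, ⟨_, hmem, rfl⟩⟩ with h | h
    · rw [← h1] at h
      linarith [hψi hmem (right_mem_Icc.2 zero_le_one) h, hs.2]
    · rw [mem_singleton_iff, ← h0] at h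
      linarith [hψi hmem (left_mem_Icc.2 zero_le_one) h]
  have hχ01 : χ 0 = χ 1 := by
    simp only [hχ, concatParam]
    norm_num
    exact h1.symm
  have : Fact ((0 : ℝ) < 1) := ⟨zero_lt_one⟩
  set L : AddCircle (1 : ℝ) → X := AddCircle.liftIco 1 0 χ with hL
  have hLc : Continuous L := AddCircle.liftIco_zero_continuous hχ01 hχc
  have hLi : Function.Injective L := by
    intro a b hab
    obtain ⟨s, hs, rfl⟩ := AddCircle.eq_coe_Ico a
    obtain ⟨t, ht, rfl⟩ := AddCircle.eq_coe_Ico b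
    rw [hL, AddCircle.liftIco_zero_coe_apply hs, AddCircle.liftIco_zero_coe_apply ht] at hab
    rw [hχi hs ht hab]
  have hLr : range L = φ '' Icc 0 1 ∪ ψ '' Icc 0 1 := by
    rw [← image_concatParam h0.symm, ← hχ]
    apply Subset.antisymm
    · rintro _ ⟨a, rfl⟩
      obtain ⟨s, hs, rfl⟩ := AddCircle.eq_coe_Ico a
      exact ⟨s, Ico_subset_Icc_self hs, (AddCircle.liftIco_zero_coe_apply hs).symm⟩
    · rintro _ ⟨s, hs, rfl⟩
      rcases hs.2.eq_or_lt with rfl | hlt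
      · rw [← hχ01]
        exact ⟨(0 : ℝ), AddCircle.liftIco_zero_coe_apply ⟨le_rfl, zero_lt_one⟩⟩
      · exact ⟨(s : ℝ), AddCircle.liftIco_zero_coe_apply ⟨hs.1, hlt⟩⟩
  rw [← hLr]
  exact ⟨(hLc.isClosedEmbedding hLi).isEmbedding.toHomeomorph.symm.trans
    (AddCircle.homeomorphCircle one_ne_zero)⟩

/-- The subsets built from a point by successively attaching arcs at an endpoint. -/
inductive IsArcBuilt : Set X → Prop
  | point (x : X) : IsArcBuilt {x}
  | attach {T : Set X} {φ : ℝ → X} (hT : IsArcBuilt T) (hc : ContinuousOn φ (Icc 0 1))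
      (hi : InjOn φ (Icc 0 1)) (h0 : φ 0 ∈ T) (hd : ∀ s ∈ Icc (0 : ℝ) 1, φ s ∈ T → s = 0) :
      IsArcBuilt (T ∪ φ '' Icc 0 1)

theorem IsArcBuilt.isCompact {T : Set X} (hT : IsArcBuilt T) : IsCompact T := by
  induction hT with
  | point x => exact isCompact_singleton
  | attach hT hc hi h0 hd ih => exact ih.union (isCompact_Icc.image_of_continuousOn hc)

/-- An arc from the old part to the attached one is routed through the attaching point `φ 0`, the
only common point. -/
theorem IsArcBuilt.exists_arc {T : Set X} (hT : IsArcBuilt T) {x y : X} (hx : x ∈ T) (hy : y ∈ T)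
    (hxy : x ≠ y) : ∃ C ⊆ T, IsArcBetween C x y := by
  induction hT generalizing x y with
  | point z => exact (hxy (hx.trans hy.symm)).elim
  | @attach T φ hT hc hi h0 hd ih =>
    have sub : ∀ u ∈ Icc (0 : ℝ) 1, ∀ v ∈ Icc (0 : ℝ) 1, u ≠ v →
        IsArcBetween (φ '' uIcc u v) (φ u) (φ v) ∧ φ '' uIcc u v ⊆ φ '' Icc 0 1 := by
      intro u hu v hv huv
      have h : uIcc u v ⊆ Icc (0 : ℝ) 1 := ordConnected_Icc.uIcc_subset hu hv
      exact ⟨isArcBetween_image_uIcc huv (hc.mono h) (hi.mono h), image_mono h⟩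
    have mixed : ∀ x ∈ T, ∀ s ∈ Icc (0 : ℝ) 1, x ≠ φ s →
        ∃ C ⊆ T ∪ φ '' Icc 0 1, IsArcBetween C x (φ s) := by
      intro x hx s hs hxs
      by_cases hs0 : s = 0
      · subst hs0
        obtain ⟨C, hC, hC'⟩ := ih hx h0 hxs
        exact ⟨C, hC.trans subset_union_left, hC'⟩
      obtain ⟨hD, hD'⟩ := sub 0 (by simp) s hs (Ne.symm hs0)
      by_cases hx0 : x = φ 0
      · subst hx0
        exact ⟨_, hD'.trans subset_union_right, hD⟩
      obtain ⟨C, hC, hC'⟩ := ih hx h0 hx0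
      refine ⟨_, union_subset_union hC hD', hC'.trans hD ?_⟩
      rintro z ⟨hzC, hzD⟩
      obtain ⟨r, hr, rfl⟩ := hD' hzD
      rw [hd r hr (hC hzC)]
      rfl
    rcases hx with hx | ⟨s, hs, rfl⟩ <;> rcases hy with hy | ⟨t, ht, rfl⟩
    · obtain ⟨C, hC, hC'⟩ := ih hx hy hxy
      exact ⟨C, hC.trans subset_union_left, hC'⟩
    · exact mixed x hx t ht hxy
    · obtain ⟨C, hC, hC'⟩ := mixed y hy s hs hxy.symm
      exact ⟨C, hC, hC'.symm⟩
    · obtain ⟨h1, h2⟩ := sub s hs t ht (fun h => hxy (congrArg φ h))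
      exact ⟨_, h2.trans subset_union_right, h1⟩

/-- This allows either orientation of the parameter interval, and the degenerate case `u = v`, where
nothing is added. -/
theorem IsArcBuilt.attach_uIcc {T : Set X} (hT : IsArcBuilt T) {φ : ℝ → X} {u v : ℝ}
    (hc : ContinuousOn φ (uIcc u v)) (hi : InjOn φ (uIcc u v)) (h0 : φ u ∈ T)
    (hd : ∀ s ∈ uIcc u v, φ s ∈ T → s = u) : IsArcBuilt (T ∪ φ '' uIcc u v) := by
  rcases eq_or_ne u v with rfl | huv
  · rwa [uIcc_self, image_singleton, union_eq_self_of_subset_right (singleton_subset_iff.2 h0)]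
  have hm : MapsTo (AffineMap.lineMap u v) (Icc (0 : ℝ) 1) (uIcc u v) :=
    mapsTo_iff_image_subset.2 (image_lineMap_Icc u v).le
  have hinj := AffineMap.lineMap_injective ℝ huv
  rw [← image_lineMap_Icc, ← image_comp]
  refine hT.attach (hc.comp (by fun_prop) hm) (hi.comp hinj.injOn hm) (by simpa using h0)
    fun s hs hsT => hinj ?_
  rw [AffineMap.lineMap_apply_zero]
  exact hd _ (hm hs) hsT

/-- The parameters at which the arc meets `T` form an interval `[m, M]`, since a gap would close up,
through an arc of `T`, to a simple closed curve. Only the two tails are new, and each is attached at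
one endpoint. -/
theorem IsArcBuilt.union_arc [T2Space X] (hX : ∀ C : Set X, ¬ IsTopSimpleClosedCurve C)
    {T : Set X} (hT : IsArcBuilt T) {a : ℝ → X} (hc : ContinuousOn a (Icc 0 1))
    (hi : InjOn a (Icc 0 1)) (hne : (T ∩ a '' Icc 0 1).Nonempty) :
    IsArcBuilt (T ∪ a '' Icc 0 1) := by
  set K := Icc (0 : ℝ) 1 ∩ a ⁻¹' T with hK
  have hKcl : IsClosed K := hc.preimage_isClosed_of_isClosed isClosed_Icc hT.isCompact.isClosed
  have hKc : IsCompact K := isCompact_Icc.of_isClosed_subset hKcl inter_subset_left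
  have hKn : K.Nonempty := by
    obtain ⟨_, hz, s, hs, rfl⟩ := hne
    exact ⟨s, hs, hz⟩
  obtain ⟨m, hm, hml⟩ := hKc.exists_isLeast hKn
  obtain ⟨M, hM, hMg⟩ := hKc.exists_isGreatest hKn
  have hmid : Icc m M ⊆ K := by
    intro t ht
    by_contra htK
    have ht01 : t ∈ Icc (0 : ℝ) 1 := ⟨hm.1.1.trans ht.1, ht.2.trans hM.1.2⟩
    -- The gap around `t`: `u` is the last parameter of `K` before `t` and `v` the first one after
    -- it.
    obtain ⟨u, ⟨huK, hut⟩, hug⟩ := (hKc.inter_right (isClosed_Iic (a := t))).exists_isGreatest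
      ⟨m, hm, ht.1⟩
    obtain ⟨v, ⟨hvK, htv⟩, hvl⟩ := (hKc.inter_right (isClosed_Ici (a := t))).exists_isLeast
      ⟨M, hM, ht.2⟩
    have hut' : u < t := lt_of_le_of_ne hut fun h => htK (h ▸ huK)
    have htv' : t < v := lt_of_le_of_ne htv fun h => htK (h ▸ hvK)
    have huv : u < v := hut'.trans htv'
    have hsub : uIcc u v ⊆ Icc 0 1 := ordConnected_Icc.uIcc_subset huK.1 hvK.1
    obtain ⟨C, hCT, hC⟩ := hT.exists_arc huK.2 hvK.2
      fun h => huv.ne (hi huK.1 hvK.1 h)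
    refine hX _ (hC.isTopSimpleClosedCurve
      (isArcBetween_image_uIcc huv.ne (hc.mono hsub) (hi.mono hsub)) ?_)
    rintro _ ⟨hzC, s, hs, rfl⟩
    have hsK : s ∈ K := ⟨hsub hs, hCT hzC⟩
    rw [uIcc_of_le huv.le] at hs
    rcases le_total s t with hst | hst
    · exact Or.inl (congrArg a (le_antisymm (hug ⟨hsK, hst⟩) hs.1))
    · exact Or.inr (congrArg a (le_antisymm hs.2 (hvl ⟨hsK, hst⟩)))
  have hmM : m ≤ M := hml hM
  have hs1 : uIcc M 1 ⊆ Icc 0 1 := ordConnected_Icc.uIcc_subset hM.1 (by simp)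
  have hs0 : uIcc m 0 ⊆ Icc 0 1 := ordConnected_Icc.uIcc_subset hm.1 (by simp)
  have h1 : IsArcBuilt (T ∪ a '' uIcc M 1) := by
    refine hT.attach_uIcc (hc.mono hs1) (hi.mono hs1) hM.2 fun s hs hsT => ?_
    refine le_antisymm (hMg ⟨hs1 hs, hsT⟩) ?_
    rw [uIcc_of_le hM.1.2] at hs
    exact hs.1
  have h2 : IsArcBuilt (T ∪ a '' uIcc M 1 ∪ a '' uIcc m 0) := by
    refine h1.attach_uIcc (hc.mono hs0) (hi.mono hs0) (Or.inl hm.2) fun s hs hsT => ?_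
    have hsm : s ≤ m := by
      rw [uIcc_of_ge hm.1.1] at hs
      exact hs.2
    refine le_antisymm hsm ?_
    -- The first tail has parameters at least `M ≥ m`, so the two tails can share only the point
    -- with `s = m = M`.
    rcases hsT with hsT | ⟨r, hr, hrs⟩
    · exact hml ⟨hs0 hs, hsT⟩
    · have := hi (hs1 hr) (hs0 hs) hrs
      subst this
      rw [uIcc_of_le hM.1.2] at hr
      exact hmM.trans hr.1
  convert! h2 using 1
  rw [union_assoc]
  apply Subset.antisymm
  · rintro _ (hz | ⟨s, hs, rfl⟩)
    · exact Or.inl hz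
    · rcases le_total s m with hsm | hsm
      · exact Or.inr (Or.inr ⟨s, by rw [uIcc_of_ge hm.1.1]; exact ⟨hs.1, hsm⟩, rfl⟩)
      · rcases le_total s M with hsM | hsM
        · exact Or.inl (hmid ⟨hsm, hsM⟩).2
        · exact Or.inr (Or.inl ⟨s, by rw [uIcc_of_le hM.1.2]; exact ⟨hsM, hs.2⟩, rfl⟩)
  · exact union_subset_union_right _ (union_subset (image_mono hs1) (image_mono hs0))

theorem IsTopArc.exists_param {A : Set X} (hA : IsTopArc A) :
    ∃ φ : ℝ → X, Continuous φ ∧ InjOn φ (Icc 0 1) ∧ φ '' Icc 0 1 = A := by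
  obtain ⟨e⟩ := hA
  refine ⟨fun s => (e.symm (projIcc 0 1 zero_le_one s) : A),
    continuous_subtype_val.comp (e.symm.continuous.comp continuous_projIcc), ?_, ?_⟩
  · intro s hs t ht hst
    have := e.symm.injective (Subtype.ext hst)
    rw [projIcc_of_mem _ hs, projIcc_of_mem _ ht] at this
    exact congrArg Subtype.val this
  · apply Subset.antisymm
    · rintro _ ⟨s, -, rfl⟩
      exact Subtype.coe_prop _
    · intro x hx
      refine ⟨e ⟨x, hx⟩, (e ⟨x, hx⟩).2, ?_⟩
      simp

theorem IsTopTree.isArcBuilt_univ (hX : IsTopTree X) : IsArcBuilt (univ : Set X) := by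
  have := hX.t2
  have := hX.connected
  obtain ⟨𝒜, hfin, harc, hcov⟩ := hX.finite_union_arcs
  suffices h : ∀ n : ℕ, ∀ 𝒜 : Set (Set X), 𝒜.Finite → 𝒜.ncard = n → (∀ A ∈ 𝒜, IsTopArc A) →
      ∀ T : Set X, IsArcBuilt T → T ∪ ⋃₀ 𝒜 = univ → IsArcBuilt (univ : Set X) by
    obtain ⟨x⟩ := (inferInstance : Nonempty X)
    exact h _ 𝒜 hfin rfl harc {x} (.point x) (by rw [hcov, union_univ])
  intro n
  induction n with
  | zero =>
    intro 𝒜 hfin hn harc T hT hcov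
    rw [ncard_eq_zero hfin] at hn
    rw [hn, sUnion_empty, union_empty] at hcov
    rwa [← hcov]
  | succ n ih =>
    intro 𝒜 hfin hn harc T hT hcov
    have hne : 𝒜.Nonempty := (ncard_pos hfin).1 (by omega)
    have hTn : T.Nonempty := by
      cases hT with
      | point x => exact singleton_nonempty x
      | attach hT hc hi h0 hd => exact ⟨_, Or.inl h0⟩
    have hAcl : IsClosed (⋃₀ 𝒜) := by
      rw [sUnion_eq_biUnion]
      refine hfin.isClosed_biUnion fun A hA => ?_
      obtain ⟨φ, hφ, -, rfl⟩ := (harc A hA).exists_param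
      exact (isCompact_Icc.image hφ).isClosed
    have hAn : (⋃₀ 𝒜).Nonempty := by
      obtain ⟨A, hA⟩ := hne
      obtain ⟨φ, -, -, rfl⟩ := (harc A hA).exists_param
      exact ⟨φ 0, _, hA, 0, by simp, rfl⟩
    -- By connectedness, some remaining arc meets the part already built.
    obtain ⟨x, -, hxT, A, hA, hxA⟩ := isPreconnected_closed_iff.1 isPreconnected_univ T (⋃₀ 𝒜)
      hT.isCompact.isClosed hAcl hcov.ge (by simpa using hTn) (by simpa using hAn)
    obtain ⟨φ, hφc, hφi, hφA⟩ := (harc A hA).exists_param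
    have hT' := hT.union_arc hX.no_simple_closed_curve hφc.continuousOn hφi
      ⟨x, hxT, hφA.symm ▸ hxA⟩
    refine ih (𝒜 \ {A}) hfin.sdiff ?_ (fun B hB => harc B hB.1) _ hT' ?_
    · rw [ncard_sdiff_singleton_of_mem hA, hn, Nat.add_sub_cancel]
    · rw [hφA, union_assoc, ← sUnion_insert, insert_sdiff_singleton, insert_eq_of_mem hA, hcov]

end Arcs

/-! ### Connected subsets and the folding homotopy. -/

section Subsets

variable {X : Type*} [TopologicalSpace X]

theorem exists_continuousOn_leftInverse_of_arc [T2Space X] {φ : ℝ → X}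
    (hc : ContinuousOn φ (Icc 0 1)) (hi : InjOn φ (Icc 0 1)) :
    ∃ ρ : X → ℝ, ContinuousOn ρ (φ '' Icc 0 1) ∧ ∀ s ∈ Icc (0 : ℝ) 1, ρ (φ s) = s := by
  have hρ : ∀ s ∈ Icc (0 : ℝ) 1, Function.invFunOn φ (Icc 0 1) (φ s) = s :=
    fun s hs => hi.leftInvOn_invFunOn hs
  refine ⟨Function.invFunOn φ (Icc 0 1), ?_, hρ⟩
  have hemb : IsClosedEmbedding ((Icc (0 : ℝ) 1).domRestrict φ) :=
    (continuousOn_iff_continuous_domRestrict.1 hc).isClosedEmbedding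
      (injOn_iff_injective.1 hi)
  rw [continuousOn_iff_continuous_domRestrict]
  have hr : φ '' Icc 0 1 = range ((Icc (0 : ℝ) 1).domRestrict φ) := (range_domRestrict _ _).symm
  rw [hr]
  refine (continuous_subtype_val.comp hemb.isEmbedding.toHomeomorph.symm.continuous).congr ?_
  rintro ⟨_, s, rfl⟩
  have : hemb.isEmbedding.toHomeomorph.symm ⟨_, s, rfl⟩ = s :=
    hemb.isEmbedding.toHomeomorph.symm_apply_apply s
  simp only [Function.comp, this]
  exact (hρ s s.2).symm

/-- An arc `φ '' [0, 1]` meets the closed set `T` exactly in its endpoint `φ 0`. -/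
structure IsArcAttached (T : Set X) (φ : ℝ → X) : Prop where
  closed : IsClosed T
  cont : ContinuousOn φ (Icc 0 1)
  inj : InjOn φ (Icc 0 1)
  zero_mem : φ 0 ∈ T
  eq_zero : ∀ s ∈ Icc (0 : ℝ) 1, φ s ∈ T → s = 0

variable {T Y : Set X} {φ : ℝ → X}

theorem IsArcAttached.eq_of_mem (h : IsArcAttached T φ) {x : X} (hx : x ∈ T)
    (hxA : x ∈ φ '' Icc 0 1) : x = φ 0 := by
  obtain ⟨s, hs, rfl⟩ := hxA
  rw [h.eq_zero s hs hx]

theorem IsArcAttached.isClosed_image [T2Space X] (h : IsArcAttached T φ) {u v : ℝ}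
    (hu : 0 ≤ u) (hv : v ≤ 1) : IsClosed (φ '' Icc u v) :=
  (isCompact_Icc.image_of_continuousOn (h.cont.mono (Icc_subset_Icc hu hv))).isClosed

/-- For `r > s ≥ 0` the closed sets `T ∪ φ '' [0, r]` and `φ '' [r, 1]` meet only in `φ r`, so a
connected set meeting both contains `φ r`. -/
theorem IsArcAttached.ordConnected [T2Space X] (h : IsArcAttached T φ) (hY : IsPreconnected Y)
    (hYT : Y ⊆ T ∪ φ '' Icc 0 1) : (Icc (0 : ℝ) 1 ∩ φ ⁻¹' Y).OrdConnected := by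
  refine ⟨fun s hs t ht r hr => ?_⟩
  have hr01 : r ∈ Icc (0 : ℝ) 1 := ⟨hs.1.1.trans hr.1, hr.2.trans ht.1.2⟩
  refine ⟨hr01, ?_⟩
  rcases hr.1.eq_or_lt with rfl | hsr
  · exact hs.2
  have hcov : Y ⊆ T ∪ φ '' Icc 0 r ∪ φ '' Icc r 1 := by
    intro y hy
    rcases hYT hy with hyT | ⟨q, hq, rfl⟩
    · exact Or.inl (Or.inl hyT)
    · rcases le_total q r with hqr | hqr
      · exact Or.inl (Or.inr ⟨q, ⟨hq.1, hqr⟩, rfl⟩)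
      · exact Or.inr ⟨q, ⟨hqr, hq.2⟩, rfl⟩
  obtain ⟨y, hyY, hy1, q, hq, rfl⟩ := isPreconnected_closed_iff.1 hY (T ∪ φ '' Icc 0 r)
    (φ '' Icc r 1) (h.closed.union (h.isClosed_image le_rfl hr01.2))
    (h.isClosed_image hr01.1 le_rfl) hcov
    ⟨φ s, hs.2, Or.inr ⟨s, ⟨hs.1.1, hr.1⟩, rfl⟩⟩ ⟨φ t, ht.2, ⟨t, ⟨hr.2, ht.1.2⟩, rfl⟩⟩
  have hq01 : q ∈ Icc (0 : ℝ) 1 := ⟨hr01.1.trans hq.1, hq.2⟩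
  rcases hy1 with hy1 | ⟨p, hp, hpq⟩
  · linarith [h.eq_zero q hq01 hy1, hq.1, hs.1.1]
  · have := h.inj ⟨hp.1, hp.2.trans hr01.2⟩ hq01 hpq
    have hqr : q = r := le_antisymm (this ▸ hp.2) hq.1
    exact hqr ▸ hyY

theorem IsArcAttached.zero_mem_of_not_subset [T2Space X] (h : IsArcAttached T φ)
    (hY : IsPreconnected Y) (hYT : Y ⊆ T ∪ φ '' Icc 0 1) (h1 : ¬ Y ⊆ T)
    (h2 : ¬ Y ⊆ φ '' Icc 0 1) : φ 0 ∈ Y := by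
  obtain ⟨x, hxY, hxT⟩ := not_subset.1 h1
  obtain ⟨y, hyY, hyA⟩ := not_subset.1 h2
  obtain ⟨z, hzY, hzT, hzA⟩ := isPreconnected_closed_iff.1 hY T (φ '' Icc 0 1) h.closed
    (h.isClosed_image le_rfl le_rfl) hYT ⟨y, hyY, (hYT hyY).resolve_right hyA⟩
    ⟨x, hxY, (hYT hxY).resolve_left hxT⟩
  exact h.eq_of_mem hzT hzA ▸ hzY

/-- `Y ∩ T` is the image of `Y` under the retraction that collapses the arc to `φ 0`. -/
theorem IsArcAttached.isPreconnected_inter [T2Space X] (h : IsArcAttached T φ)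
    (hY : IsPreconnected Y) (hYT : Y ⊆ T ∪ φ '' Icc 0 1) (h0 : φ 0 ∈ Y) :
    IsPreconnected (Y ∩ T) := by
  classical
  set r : X → X := fun x => if x ∈ T then x else φ 0 with hr
  have hrc : ContinuousOn r (T ∪ φ '' Icc 0 1) := by
    refine ContinuousOn.union_of_isClosed ?_ ?_ h.closed (h.isClosed_image le_rfl le_rfl)
    · exact continuousOn_id.congr fun x hx => if_pos hx
    · refine (continuousOn_const (c := φ 0)).congr fun x hx => ?_
      by_cases hxT : x ∈ T
      · simp only [hr, if_pos hxT]
        exact h.eq_of_mem hxT hx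
      · simp only [hr, if_neg hxT]
  have : Y ∩ T = r '' Y := by
    apply Subset.antisymm
    · rintro x ⟨hxY, hxT⟩
      exact ⟨x, hxY, if_pos hxT⟩
    · rintro _ ⟨x, hxY, rfl⟩
      by_cases hxT : x ∈ T
      · simp only [hr, if_pos hxT]
        exact ⟨hxY, hxT⟩
      · simp only [hr, if_neg hxT]
        exact ⟨h0, h.zero_mem⟩
  rw [this]
  exact hY.image r (hrc.mono hYT)

/-- Every point of a nondegenerate connected subset is the endpoint of an arc in the subset. -/
theorem IsArcBuilt.exists_arc_of_isPreconnected [T2Space X] (hT : IsArcBuilt T) (hYT : Y ⊆ T)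
    (hY : IsPreconnected Y) (hYn : Y.Nontrivial) {c : X} (hcY : c ∈ Y) :
    ∃ C ⊆ Y, ∃ y, IsArcBetween C c y := by
  induction hT generalizing Y c with
  | point x => exact (not_nontrivial_singleton (hYn.mono hYT)).elim
  | @attach T φ hT hc hi h0 hd ih =>
    have h : IsArcAttached T φ := ⟨hT.isCompact.isClosed, hc, hi, h0, hd⟩
    have hoc := h.ordConnected hY hYT
    have key : ∀ s ∈ Icc (0 : ℝ) 1 ∩ φ ⁻¹' Y, ∀ t ∈ Icc (0 : ℝ) 1 ∩ φ ⁻¹' Y, s ≠ t →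
        ∃ C ⊆ Y, ∃ y, IsArcBetween C (φ s) y := by
      intro s hs t ht hst
      have hsub := hoc.uIcc_subset hs ht
      refine ⟨φ '' uIcc s t, ?_, φ t, isArcBetween_image_uIcc hst
        (hc.mono (hsub.trans inter_subset_left)) (hi.mono (hsub.trans inter_subset_left))⟩
      rintro _ ⟨r, hr, rfl⟩
      exact (hsub hr).2
    by_cases hYT' : Y ⊆ T
    · exact ih hYT' hY hYn hcY
    by_cases hYA : Y ⊆ φ '' Icc 0 1
    · obtain ⟨y, hy, hyc⟩ := hYn.exists_ne c
      obtain ⟨s, hs, rfl⟩ := hYA hcY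
      obtain ⟨t, ht, rfl⟩ := hYA hy
      exact key s ⟨hs, hcY⟩ t ⟨ht, hy⟩ fun hst => hyc (congrArg φ hst.symm)
    have h0Y := h.zero_mem_of_not_subset hY hYT hYT' hYA
    obtain ⟨y, hyY, hyT⟩ := not_subset.1 hYT'
    obtain ⟨s, hs, rfl⟩ := (hYT hyY).resolve_left hyT
    have hs0 : s ≠ 0 := fun hs0 => hyT (hs0 ▸ h0)
    have z0 : (0 : ℝ) ∈ Icc (0 : ℝ) 1 ∩ φ ⁻¹' Y := ⟨by simp, h0Y⟩
    by_cases hcA : c ∈ φ '' Icc 0 1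
    · obtain ⟨t, ht, rfl⟩ := hcA
      by_cases ht0 : t = 0
      · subst ht0
        exact key 0 z0 s ⟨hs, hyY⟩ hs0.symm
      · exact key t ⟨ht, hcY⟩ 0 z0 ht0
    · have hcT := (hYT hcY).resolve_right hcA
      obtain ⟨C, hC, hC'⟩ := ih inter_subset_right (h.isPreconnected_inter hY hYT h0Y)
        ⟨c, ⟨hcY, hcT⟩, φ 0, ⟨h0Y, h0⟩, fun e => hcA ⟨0, by simp, e.symm⟩⟩ ⟨hcY, hcT⟩
      exact ⟨C, hC.trans inter_subset_left, hC'⟩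

/-- The inverse parametrization identifies `Y` with a nondegenerate real interval. -/
theorem IsArcAttached.contractibleSpace_of_subset_image [T2Space X] (h : IsArcAttached T φ)
    (hY : IsPreconnected Y) (hYn : Y.Nontrivial) (hYA : Y ⊆ φ '' Icc 0 1) :
    ContractibleSpace (ConvergentSeqHyperspace Y) := by
  obtain ⟨ρ, hρc, hρ⟩ := exists_continuousOn_leftInverse_of_arc h.cont h.inj
  have hoc := h.ordConnected hY (hYA.trans subset_union_right)
  have hφρ : ∀ y ∈ Y, ρ y ∈ Icc (0 : ℝ) 1 ∧ φ (ρ y) = y := fun y hy => by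
    obtain ⟨s, hs, rfl⟩ := hYA hy
    rw [hρ s hs]
    exact ⟨hs, rfl⟩
  let e : Y ≃ₜ (Icc (0 : ℝ) 1 ∩ φ ⁻¹' Y : Set ℝ) :=
    { toFun := fun y => ⟨ρ y, (hφρ y y.2).1, by
        rw [mem_preimage, (hφρ y y.2).2]
        exact y.2⟩
      invFun := fun s => ⟨φ s, s.2.2⟩
      left_inv := fun y => Subtype.ext (hφρ y y.2).2
      right_inv := fun s => Subtype.ext (hρ s s.2.1)
      continuous_toFun := (continuousOn_iff_continuous_domRestrict.1 (hρc.mono hYA)).subtype_mk _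
      continuous_invFun :=
        (continuousOn_iff_continuous_domRestrict.1 (h.cont.mono inter_subset_left)).subtype_mk _ }
  have hJn : (Icc (0 : ℝ) 1 ∩ φ ⁻¹' Y).Nontrivial := by
    have : Nontrivial Y := hYn.coe_sort
    exact nontrivial_coe_sort.1 e.injective.nontrivial
  have := hoc.contractibleSpace_convergentSeqHyperspace hJn
  exact e.contractibleSpace_convergentSeqHyperspace

/-- The path that runs through `α` backwards on `[-1, 0]` and through `φ` on `[0, 1]`. -/
noncomputable def twoSidedParam {X : Type*} (α φ : ℝ → X) (r : ℝ) : X :=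
  if 0 ≤ r then φ r else α (-r)

theorem continuousOn_twoSidedParam {α φ : ℝ → X} (hα : ContinuousOn α (Icc 0 1))
    (hφ : ContinuousOn φ (Icc 0 1)) (h : α 0 = φ 0) :
    ContinuousOn (twoSidedParam α φ) (Icc (-1) 1) := by
  have e : Icc (-1 : ℝ) 1 = Icc (-1) 0 ∪ Icc 0 1 :=
    (Icc_union_Icc_eq_Icc (by norm_num) (by norm_num)).symm
  rw [e]
  refine ContinuousOn.union_of_isClosed ?_ ?_ isClosed_Icc isClosed_Icc
  · refine (hα.comp (f := fun s : ℝ => -s) (by fun_prop) fun s hs => ?_).congr fun s hs => ?_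
    · constructor <;> linarith [hs.1, hs.2]
    · rcases hs.2.eq_or_lt with rfl | hlt
      · simp [twoSidedParam, h]
      · simp only [twoSidedParam, if_neg (not_le.2 hlt), Function.comp]
  · exact hφ.congr fun s hs => if_pos hs.1

/-- Each half contributes at most one parameter. -/
theorem finite_fiber_twoSidedParam {X : Type*} {α φ : ℝ → X} (hα : InjOn α (Icc 0 1))
    (hφ : InjOn φ (Icc 0 1)) (z : X) :
    (Icc (-1) 1 ∩ twoSidedParam α φ ⁻¹' {z}).Finite := by
  have h1 : (Icc 0 1 ∩ φ ⁻¹' {z}).Subsingleton := fun s hs t ht =>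
    hφ hs.1 ht.1 (hs.2.trans ht.2.symm)
  have h2 : (Icc 0 1 ∩ α ⁻¹' {z}).Subsingleton := fun s hs t ht =>
    hα hs.1 ht.1 (hs.2.trans ht.2.symm)
  refine (h1.finite.union (h2.finite.image fun s => -s)).subset ?_
  rintro r ⟨hr, hrz⟩
  simp only [mem_preimage, twoSidedParam, mem_singleton_iff] at hrz
  split_ifs at hrz with h
  · exact Or.inl ⟨⟨h, hr.2⟩, hrz⟩
  · push Not at h
    exact Or.inr ⟨-r, ⟨⟨by linarith, by linarith [hr.1]⟩, hrz⟩, neg_neg r⟩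

/-- Folding an attached arc into the rest of the set. -/
theorem IsArcAttached.contractibleSpace_of_inter [T2Space X] (h : IsArcAttached T φ)
    (hY : IsPreconnected Y) (hYT : Y ⊆ T ∪ φ '' Icc 0 1) (h0 : φ 0 ∈ Y)
    {C : Set X} (hC : C ⊆ Y ∩ T) {c : X} (hCarc : IsArcBetween C (φ 0) c)
    [ContractibleSpace (ConvergentSeqHyperspace (Y ∩ T : Set X))] :
    ContractibleSpace (ConvergentSeqHyperspace Y) := by
  classical
  obtain ⟨α, hαc, hαi, hα0, -, rfl⟩ := hCarc
  obtain ⟨ρ, hρc, hρ⟩ := exists_continuousOn_leftInverse_of_arc h.cont h.inj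
  have hoc := h.ordConnected hY hYT
  have hk := continuousOn_twoSidedParam hαc h.cont hα0
  have hkfin := finite_fiber_twoSidedParam hαi h.inj
  set k := twoSidedParam α φ with hkdef
  have hk0 : k 0 = φ 0 := if_pos le_rfl
  have hfold : ∀ t ∈ Icc (0 : ℝ) 1, ∀ s ∈ Icc (0 : ℝ) 1,
      |s - t| - t ∈ Icc (-1 : ℝ) 1 ∧ |s - t| - t ≤ s := fun t ht s hs => by
    have h1 : |s - t| ≤ s + t := abs_le.2 ⟨by linarith [hs.1], by linarith [ht.1]⟩
    exact ⟨⟨by linarith [abs_nonneg (s - t), ht.2], by linarith [hs.2]⟩, by linarith⟩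
  -- On the arc, `s ↦ |s - t| - t` is `-s` up to `t` and `s - 2t` afterwards: a fold at `t`, fixing
  -- `0`. It is the identity at `t = 0` and `s ↦ -s` at `t = 1`, when `φ s` has moved to `α s`.
  set G : ℝ × X → X := fun a => if a.2 ∈ T then a.2 else k (|ρ a.2 - a.1| - a.1) with hG
  have hGT : ∀ t, ∀ x ∈ T, G (t, x) = x := fun t x hx => if_pos hx
  have hGA : ∀ t ∈ Icc (0 : ℝ) 1, ∀ s ∈ Icc (0 : ℝ) 1, G (t, φ s) = k (|s - t| - t) := by
    intro t ht s hs
    by_cases hsT : φ s ∈ T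
    · rw [hGT t _ hsT, h.eq_zero s hs hsT, zero_sub, abs_neg, abs_of_nonneg ht.1, sub_self, hk0]
    · simp only [hG, if_neg hsT, hρ s hs]
  have hGc : ContinuousOn G (Icc 0 1 ×ˢ (T ∪ φ '' Icc 0 1)) := by
    rw [prod_union]
    refine ContinuousOn.union_of_isClosed ?_ ?_ (isClosed_Icc.prod h.closed)
      (isClosed_Icc.prod (h.isClosed_image le_rfl le_rfl))
    · exact continuousOn_snd.congr fun a ha => hGT a.1 a.2 ha.2
    · have h1 : ContinuousOn (fun a : ℝ × X => |ρ a.2 - a.1| - a.1) (Icc 0 1 ×ˢ (φ '' Icc 0 1)) :=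
        (((hρc.comp continuousOn_snd fun a ha => ha.2).sub continuousOn_fst).abs).sub
          continuousOn_fst
      refine (hk.comp h1 ?_).congr ?_
      · rintro ⟨t, _⟩ ⟨ht, s, hs, rfl⟩
        simp only [hρ s hs]
        exact (hfold t ht s hs).1
      · rintro ⟨t, _⟩ ⟨ht, s, hs, rfl⟩
        simp only [Function.comp, hρ s hs]
        exact hGA t ht s hs
  have hGY : ∀ t ∈ Icc (0 : ℝ) 1, ∀ y ∈ Y, G (t, y) ∈ Y := by
    intro t ht y hy
    rcases hYT hy with hyT | ⟨s, hs, rfl⟩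
    · rwa [hGT t y hyT]
    · rw [hGA t ht s hs, hkdef, twoSidedParam]
      obtain ⟨h1, h2⟩ := hfold t ht s hs
      split_ifs with hpos
      -- A nonnegative folded parameter lies between `0` and `s`, hence stays in `Y`; a negative one
      -- lands on the arc `α` inside `Y`.
      · exact (hoc.out ⟨by simp, h0⟩ ⟨hs, hy⟩ ⟨hpos, h2⟩).2
      · push Not at hpos
        exact (hC ⟨_, ⟨by linarith, by linarith [h1.1]⟩, rfl⟩).1
  have hG0 : ∀ y ∈ Y, G (0, y) = y := by
    intro y hy
    rcases hYT hy with hyT | ⟨s, hs, rfl⟩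
    · exact hGT 0 y hyT
    · rw [hGA 0 (by simp) s hs, sub_zero, sub_zero, abs_of_nonneg hs.1]
      exact if_pos hs.1
  have hG1 : ∀ y ∈ Y, G (1, y) ∈ Y ∩ T := by
    intro y hy
    rcases hYT hy with hyT | ⟨s, hs, rfl⟩
    · rw [hGT 1 y hyT]
      exact ⟨hy, hyT⟩
    · rw [hGA 1 (by simp) s hs, abs_of_nonpos (by linarith [hs.2])]
      rcases hs.1.eq_or_lt with rfl | hpos
      · simp only [zero_sub, neg_neg, sub_self, hk0]
        exact ⟨h0, h.zero_mem⟩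
      · rw [hkdef, twoSidedParam, if_neg (by linarith)]
        exact hC ⟨_, ⟨by linarith, by linarith [hs.2]⟩, rfl⟩
  have hHc : Continuous fun a : I × Y => G (a.1, a.2) :=
    hGc.comp_continuous (by fun_prop) fun a => ⟨a.1.2, hYT a.2.2⟩
  have hGfin : ∀ t : I, ∀ z : X, (Y ∩ {y | G (t, y) = z}).Finite := by
    intro t z
    -- The two branches of the fold are inverted by `r ↦ r + 2t` and `r ↦ -r`.
    have h1 := ((hkfin z).image fun r => r + 2 * (t : ℝ)).union ((hkfin z).image fun r => -r)
    refine ((finite_singleton z).union (h1.image φ)).subset ?_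
    rintro y ⟨hy, hyz⟩
    rw [mem_ofPred] at hyz
    rcases hYT hy with hyT | ⟨s, hs, rfl⟩
    · rw [hGT _ y hyT] at hyz
      exact Or.inl hyz
    · rw [hGA t t.2 s hs] at hyz
      refine Or.inr ⟨s, ?_, rfl⟩
      have hmem : |s - t| - t ∈ Icc (-1) 1 ∩ k ⁻¹' {z} := ⟨(hfold t t.2 s hs).1, hyz⟩
      rcases le_total (t : ℝ) s with hts | hts
      · exact Or.inl ⟨_, hmem, by rw [abs_of_nonneg (by linarith)]; ring⟩
      · exact Or.inr ⟨_, hmem, by rw [abs_of_nonpos (by linarith)]; ring⟩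
  let r : C(Y, (Y ∩ T : Set X)) := ⟨fun y => ⟨G (1, y), hG1 y y.2⟩,
    (hHc.comp (by fun_prop : Continuous fun y : Y => ((1 : I), y))).subtype_mk _⟩
  let i : C((Y ∩ T : Set X), Y) := ⟨fun y => ⟨y, y.2.1⟩, by fun_prop⟩
  let H : (ContinuousMap.id Y).Homotopy (i.comp r) :=
    { toFun := fun a => ⟨G (a.1, a.2), hGY a.1 a.1.2 a.2 a.2.2⟩
      continuous_toFun := hHc.subtype_mk _
      map_zero_left := fun y => Subtype.ext (hG0 y y.2)
      map_one_left := fun y => rfl }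
  refine ConvergentSeqHyperspace.contractibleSpace_of_dominated r i (fun y => ?_) H fun t z => ?_
  · refine (finite_singleton y).preimage fun a _ b _ hab => ?_
    exact Subtype.ext (congrArg (fun y : Y => (y : X)) hab)
  · refine ((hGfin t z).preimage Subtype.val_injective.injOn).subset fun y hy => ?_
    exact ⟨y.2, congrArg Subtype.val hy⟩

theorem IsArcBuilt.contractibleSpace_convergentSeqHyperspace [T2Space X] (hT : IsArcBuilt T)
    (hYT : Y ⊆ T) (hY : IsPreconnected Y) (hYn : Y.Nontrivial) :
    ContractibleSpace (ConvergentSeqHyperspace Y) := by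
  induction hT generalizing Y with
  | point x => exact (not_nontrivial_singleton (hYn.mono hYT)).elim
  | @attach T φ hT hc hi h0 hd ih =>
    have h : IsArcAttached T φ := ⟨hT.isCompact.isClosed, hc, hi, h0, hd⟩
    by_cases hYT' : Y ⊆ T
    · exact ih hYT' hY hYn
    by_cases hYA : Y ⊆ φ '' Icc 0 1
    · exact h.contractibleSpace_of_subset_image hY hYn hYA
    have h0Y := h.zero_mem_of_not_subset hY hYT hYT' hYA
    have hconn := h.isPreconnected_inter hY hYT h0Y
    obtain ⟨y, hyY, hyA⟩ := not_subset.1 hYA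
    have hn : (Y ∩ T).Nontrivial := ⟨y, ⟨hyY, (hYT hyY).resolve_right hyA⟩, φ 0, ⟨h0Y, h0⟩,
      fun e => hyA ⟨0, by simp, e.symm⟩⟩
    -- This arc of `Y ∩ T` starting at `φ 0` receives the folded one.
    obtain ⟨C, hC, c, hCarc⟩ :=
      hT.exists_arc_of_isPreconnected inter_subset_right hconn hn ⟨h0Y, h0⟩
    have := ih inter_subset_right hconn hn
    exact h.contractibleSpace_of_inter hY hYT h0Y hC hCarc

end Subsets

theorem mainTheorem6 {X : Type*} [TopologicalSpace X] (hX : IsTopTree X)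
    (Y : Set X) (hYconn : IsConnected Y) (hYnondeg : Y.Nontrivial) :
    ContractibleSpace (ConvergentSeqHyperspace Y) := by
  have := hX.t2
  exact hX.isArcBuilt_univ.contractibleSpace_convergentSeqHyperspace (subset_univ Y)
    hYconn.isPreconnected hYnondeg
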